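/- Let $X_1,X_2,\ldots$ be independent and identically distributed real random variables such that $X_1$ is simple (there is a finite set $S\subset\mathbf{R}$ with $\mathbf{P}(X_1\in S)=1$), $\mathbf{E}[X_1]=0$ and $\mathbf{E}[X_1^2]=1$. Let $Z$ be a standard normal random variable, that is, $\mathbf{P}(Z\le x)=\int_{-\infty}^x \frac{e^{-t^2/2}}{\sqrt{2\pi}}\,dt$ for all $x\in\mathbf{R}$. Then $\frac{X_1+\cdots+X_n}{\sqrt n}$ converges in distribution to $Z$: $$\lim_{n\to\infty}\mathbf{P}\Bigl(\frac{X_1+\cdots+X_n}{\sqrt n}\le x\Bigr)=\mathbf{P}(Z\le x)\qquad\text{for all }x\in\mathbf{R}.$$ -/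

import Mathlib

open MeasureTheory ProbabilityTheory Filter Topology

/-! The central limit theorem `tendstoInDistribution_inv_sqrt_mul_sum` gives weak convergence of the
laws; the portmanteau theorem turns it into convergence of distribution functions wherever the limit
law has no atom. -/

/-- Convergence in distribution of real random variables implies convergence of the distribution
functions at every point which the law of the limit does not charge. -/
theorem MeasureTheory.TendstoInDistribution.tendsto_measureReal_le {ι Ω Ω' : Type*}
    [MeasurableSpace Ω] [MeasurableSpace Ω'] {P : Measure Ω} [IsProbabilityMeasure P]
    {P' : Measure Ω'} [IsProbabilityMeasure P'] {Y : ι → Ω → ℝ} {Z : Ω' → ℝ} {l : Filter ι}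
    (h : TendstoInDistribution Y l Z (fun _ => P) P') {x : ℝ} (hx : P'.map Z {x} = 0) :
    Tendsto (fun i => P.real {ω | Y i ω ≤ x}) l (𝓝 (P'.real {ω' | Z ω' ≤ x})) := by
  -- The frontier of `Set.Iic x` is `{x}`, null by `hx`.
  have key := ProbabilityMeasure.tendsto_measure_of_null_frontier_of_tendsto' h.tendsto
    (E := Set.Iic x) (by simpa [frontier_Iic] using hx)
  have hZ := Measure.map_apply_of_aemeasurable h.aemeasurable_limit (measurableSet_Iic (a := x))
  have hY i := Measure.map_apply_of_aemeasurable (h.forall_aemeasurable i)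
    (measurableSet_Iic (a := x))
  simp only [ProbabilityMeasure.coe_mk, hZ, hY] at key
  exact (ENNReal.tendsto_toReal (measure_ne_top _ _)).comp key

theorem lemma4 {Ω Ω' : Type*} [MeasurableSpace Ω] [MeasurableSpace Ω']
    (P : Measure Ω) [IsProbabilityMeasure P] (P' : Measure Ω') [IsProbabilityMeasure P']
    (Z : Ω' → ℝ) (hZ : HasLaw Z (gaussianReal 0 1) P')
    (X : ℕ → Ω → ℝ) (hindep : iIndepFun X P)
    (hident : ∀ i : ℕ, IdentDistrib (X i) (X 0) P P)
    (hsimple : ∃ s : Finset ℝ, ∀ᵐ ω ∂P, X 0 ω ∈ s)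
    (hmean : ∫ ω, X 0 ω ∂P = 0) (hvar : ∫ ω, (X 0 ω) ^ 2 ∂P = 1) :
    ∀ x : ℝ, Tendsto
      (fun n : ℕ => P.real {ω | (∑ k ∈ Finset.range n, X k ω) / Real.sqrt (n : ℝ) ≤ x})
      atTop (𝓝 (P'.real {ω' | Z ω' ≤ x})) := by
  intro x
  -- Nonzero variance rules out a Dirac mass, so no `x` is an atom.
  have := nullSingletonClass_gaussianReal (μ := 0) (v := 1) one_ne_zero
  simp only [div_eq_inv_mul]
  exact (tendstoInDistribution_inv_sqrt_mul_sum hZ hmean hvar hindep hident).tendsto_measureReal_le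
    (by rw [hZ.map_eq]; exact measure_singleton x)
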